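/- Let $G$ be a discrete amenable group, i.e. a group such that there is a positive linear functional $M$ on the space $\ell^\infty(G)$ of bounded real functions on $G$ with $M(1)=1$ that is invariant under left translations. Let $E$ be a chordal subset of $G$; that is, $E$ is symmetric ($E^{-1}=E$), contains the neutral element $e$, and has the following property: whenever $n\ge 4$ and $s_1,\dots,s_n\in E$ satisfy $s_n\cdots s_2s_1=e$, there exist $i,k\in\{1,\dots,n\}$ with $2\le k-i\le n-2$ such that $s_{k-1}s_{k-2}\cdots s_i\in E$. Let $u:E\to\mathbb{C}$ be positive definite, i.e. for all $n$ and all $s_1,\dots,s_n\in G$ with $s_is_j^{-1}\in E$ for $1\le i,j\le n$, the matrix $(u(s_is_j^{-1}))_{i,j=1}^n$ is positive semidefinite. Then there is a positive definite function $v:G\to\mathbb{C}$ (i.e. the matrix $(v(s_is_j^{-1}))_{i,j=1}^n$ is positive semidefinite for all $n$ and all $s_1,\dots,s_n\in G$) such that $v|_E=u$. -/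

import Mathlib

open scoped ComplexOrder

/-- Amenability of a discrete group: there is a left-invariant mean on `ℓ^∞(G)`, i.e. a positive
unital linear functional `M` with `M f' = M f` whenever `f'` is the left translate
`x ↦ f (g⁻¹ x)` of `f`. -/
def IsDiscreteAmenable (G : Type*) [Group G] : Prop :=
  ∃ M : lp (fun _ : G => ℝ) ⊤ →ₗ[ℝ] ℝ,
    M 1 = 1 ∧
    (∀ f : lp (fun _ : G => ℝ) ⊤, (∀ x, 0 ≤ f x) → 0 ≤ M f) ∧
    ∀ (g : G) (f f' : lp (fun _ : G => ℝ) ⊤), (∀ x, f' x = f (g⁻¹ * x)) → M f' = M f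

/-- `descProd s i m` is the product of the `m` consecutive terms `s (i+m-1) ⋯ s (i+1) * s i`, in
descending order of the indices. -/
def descProd {G : Type*} [Group G] (s : ℕ → G) (i : ℕ) : ℕ → G
  | 0 => 1
  | m + 1 => s (i + m) * descProd s i m

/-- A chordal subset of a group: a symmetric set `E` containing `1` such that, whenever `n ≥ 4`
and `s₁, …, sₙ ∈ E` satisfy `sₙ ⋯ s₂ s₁ = 1`, there are `i, k ∈ {1, …, n}` with
`2 ≤ k - i ≤ n - 2` and `sₖ₋₁ ⋯ sᵢ ∈ E`. -/
structure IsChordalSubset {G : Type*} [Group G] (E : Set G) : Prop where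
  inv_mem : ∀ x ∈ E, x⁻¹ ∈ E
  one_mem : (1 : G) ∈ E
  exists_chord : ∀ (n : ℕ) (s : ℕ → G), 4 ≤ n → (∀ j ∈ Finset.Icc 1 n, s j ∈ E) →
    descProd s 1 n = 1 →
    ∃ i ∈ Finset.Icc 1 n, ∃ k ∈ Finset.Icc 1 n,
      i + 2 ≤ k ∧ k + 2 ≤ i + n ∧ descProd s i (k - i) ∈ E

/-- A function `u : E → ℂ` on a subset of a group is positive definite if the matrix
`(u (sᵢ sⱼ⁻¹))` is positive semidefinite for all `s₁, …, sₙ ∈ G` such that all the `sᵢ sⱼ⁻¹` lie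
in `E`. -/
def IsPosDefOn {G : Type*} [Group G] (E : Set G) (u : E → ℂ) : Prop :=
  ∀ (n : ℕ) (s : Fin n → G) (h : ∀ i j, s i * (s j)⁻¹ ∈ E),
    (Matrix.of fun i j : Fin n => u ⟨s i * (s j)⁻¹, h i j⟩).PosSemidef

/-- A function `v : G → ℂ` on a group is positive definite if the matrix `(v (sᵢ sⱼ⁻¹))` is
positive semidefinite for all `s₁, …, sₙ ∈ G`. -/
def IsPosDefFun {G : Type*} [Group G] (v : G → ℂ) : Prop :=
  ∀ (n : ℕ) (s : Fin n → G),
    (Matrix.of fun i j : Fin n => v (s i * (s j)⁻¹)).PosSemidef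

/-! Join x and y in G when x y⁻¹ ∈ E. Chordality of E makes this graph chordal, and k(x,y) = u(x
y⁻¹) is a partial kernel that is positive semidefinite on finite cliques. A finite chordal graph
that is not complete splits along a clique separator, and Gram representations of the two pieces
glue over it, so by induction k is a Gram kernel on every finite set (`IsChordalRel.hasGramOn`). The
constant diagonal u(1) bounds these completions, and a limit along an ultrafilter gives a bounded
positive semidefinite K on G × G. K need not be invariant. Averaging x ↦ K(gx, x) with the mean
gives a positive definite v; for g ∈ E the averaged function is constantly u(g), so v extends u. -/

/-- The partial kernel `k`, known on related pairs only, is on `F` the Gram kernel of a family of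
vectors of some inner product space. -/
def HasGramOn {V : Type*} (R : V → V → Prop) (k : V → V → ℂ) (F : Finset V) : Prop :=
  ∃ (H : Type) (_ : NormedAddCommGroup H) (_ : InnerProductSpace ℂ H) (f : V → H),
    ∀ x ∈ F, ∀ y ∈ F, R x y → inner ℂ (f x) (f y) = k x y

/-- Two Gram representations can be amalgamated over a clique that separates their domains. -/
theorem HasGramOn.union {V : Type*} [DecidableEq V] {R : V → V → Prop} {k : V → V → ℂ}
    {X Y : Finset V} (hX : HasGramOn R k X) (hY : HasGramOn R k Y)
    (hsymm : ∀ x y, R x y → R y x) (hclique : ∀ x ∈ X ∩ Y, ∀ y ∈ X ∩ Y, R x y)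
    (hsep : ∀ x ∈ X, x ∉ Y → ∀ y ∈ Y, y ∉ X → ¬ R x y) : HasGramOn R k (X ∪ Y) := by
  obtain ⟨H₁, _, _, a, ha⟩ := hX
  obtain ⟨H₂, _, _, b, hb⟩ := hY
  set S := X ∩ Y
  let K := Submodule.span ℂ (b '' (S : Set V))
  have : FiniteDimensional ℂ K :=
    FiniteDimensional.span_of_finite ℂ ((Finset.finite_toSet S).image b)
  have hK : ∀ s ∈ S, b s ∈ K := fun s hs => Submodule.subset_span ⟨s, hs, rfl⟩
  have hproj : ∀ y, ∃ c : V → ℂ, ∑ s ∈ S, c s • b s = K.starProjection (b y) := fun y =>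
    (Submodule.mem_span_image_finset_iff_exists_fun' ℂ).1 (K.starProjection_apply_mem (b y))
  choose c hc using hproj
  -- Copy in `H₁` of the projection of `b y` to the span over `S`. Inner products survive because
  -- `a` and `b` have the same Gram matrix on the clique `S`.
  let p : V → H₁ := fun y => ∑ s ∈ S, c y s • a s
  have hab : ∀ s ∈ S, ∀ t ∈ S, inner ℂ (a s) (a t) = inner ℂ (b s) (b t) := by
    intro s hs t ht
    have hs' := Finset.mem_inter.1 hs
    have ht' := Finset.mem_inter.1 ht
    rw [ha s hs'.1 t ht'.1 (hclique s hs t ht), hb s hs'.2 t ht'.2 (hclique s hs t ht)]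
  have horth : ∀ x, ∀ w ∈ K, inner ℂ w (b x - K.starProjection (b x)) = 0 := fun x w hw =>
    Submodule.inner_right_of_mem_orthogonal hw (K.sub_starProjection_mem_orthogonal (b x))
  have hap' : ∀ s ∈ S, ∀ y, inner ℂ (a s) (p y) = inner ℂ (b s) (K.starProjection (b y)) := by
    intro s hs y
    rw [← hc, inner_sum, inner_sum]
    exact Finset.sum_congr rfl fun t ht => by
      rw [inner_smul_right, inner_smul_right, hab s hs t ht]
  have hap : ∀ s ∈ S, ∀ y, inner ℂ (a s) (p y) = inner ℂ (b s) (b y) := by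
    intro s hs y
    have := horth y (b s) (hK s hs)
    rw [inner_sub_right, sub_eq_zero] at this
    rw [hap' s hs, this]
  have hpp : ∀ x y, inner ℂ (p x) (p y) =
      inner ℂ (K.starProjection (b x)) (K.starProjection (b y)) := by
    intro x y
    rw [← hc x, sum_inner, sum_inner]
    exact Finset.sum_congr rfl fun t ht => by
      rw [inner_smul_left, inner_smul_left, hap' t ht]
  -- Outside `X`, the component of `b x` in `K` is moved into `H₁`; the orthogonal remainder stays
  -- in `H₂`, perpendicular to every vector from `X`.
  refine ⟨WithLp 2 (H₁ × H₂), inferInstance, inferInstance,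
    fun x => if x ∈ X then WithLp.toLp 2 (a x, 0)
      else WithLp.toLp 2 (p x, b x - K.starProjection (b x)), ?_⟩
  intro x hx y hy hxy
  by_cases hxX : x ∈ X <;> by_cases hyX : y ∈ X
  · simp [hxX, hyX, ha x hxX y hyX hxy]
  · have hyY : y ∈ Y := by simpa [hyX] using hy
    have hxY : x ∈ Y := by
      by_contra h
      exact hsep x hxX h y hyY hyX hxy
    have hxS : x ∈ S := Finset.mem_inter.2 ⟨hxX, hxY⟩
    simp [hxX, hyX, hap x hxS y, hb x hxY y hyY hxy]
  · have hxY : x ∈ Y := by simpa [hxX] using hx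
    have hyY : y ∈ Y := by
      by_contra h
      exact hsep y hyX h x hxY hxX (hsymm _ _ hxy)
    have hyS : y ∈ S := Finset.mem_inter.2 ⟨hyX, hyY⟩
    have : inner ℂ (p x) (a y) = inner ℂ (b x) (b y) := by
      rw [← inner_conj_symm, hap y hyS x, inner_conj_symm]
    simp [hxX, hyX, this, hb x hxY y hyY hxy]
  · have hxY : x ∈ Y := by simpa [hxX] using hx
    have hyY : y ∈ Y := by simpa [hyX] using hy
    have h1 := horth y _ (K.starProjection_apply_mem (b x))
    have h2 := horth x _ (K.starProjection_apply_mem (b y))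
    rw [← inner_conj_symm, map_eq_zero] at h2
    rw [← hb x hxY y hyY hxy]
    simp only [hxX, hyX, if_false, WithLp.prod_inner_apply, hpp]
    rw [inner_sub_right, h2, sub_zero, inner_sub_left]
    rw [inner_sub_right, sub_eq_zero] at h1
    rw [h1]
    ring

/-! ### Chordal graphs and clique separators -/

/-- In the graph `R`, every closed walk of length at least `4` has a chord. -/
def IsChordalRel {V : Type*} (R : V → V → Prop) : Prop :=
  ∀ (n : ℕ) (v : ℕ → V), 4 ≤ n → v n = v 0 → (∀ i < n, R (v i) (v (i + 1))) →
    ∃ i k, i + 2 ≤ k ∧ k + 2 ≤ i + n ∧ k < n ∧ R (v i) (v k)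

theorem Relation.ReflTransGen.exists_walk {V : Type*} {r : V → V → Prop} {x y : V}
    (h : Relation.ReflTransGen r x y) :
    ∃ (n : ℕ) (p : ℕ → V), p 0 = x ∧ p n = y ∧ ∀ i < n, r (p i) (p (i + 1)) := by
  induction h using Relation.ReflTransGen.head_induction_on with
  | refl => exact ⟨0, fun _ => y, rfl, rfl, by simp⟩
  | @head a c hac _ ih =>
    obtain ⟨n, p, h0, hn, hp⟩ := ih
    refine ⟨n + 1, fun i => Nat.casesOn i a p, rfl, hn, ?_⟩
    rintro (_ | i) hi
    · simpa [h0] using hac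
    · exact hp i (by omega)

/-- If two neighbours `s`, `t` of `a` are joined by a walk whose interior consists of
non-neighbours of `a`, then `s` and `t` are adjacent. -/
theorem IsChordalRel.adj_of_walk {V : Type*} {R : V → V → Prop} (hR : IsChordalRel R)
    (hrefl : ∀ x, R x x) (hsymm : ∀ x y, R x y → R y x) {a s t : V} (has : R a s) (hat : R a t)
    (hwalk : ∃ (l : ℕ) (p : ℕ → V), p 0 = s ∧ p l = t ∧ (∀ i < l, R (p i) (p (i + 1))) ∧
      ∀ i, 0 < i → i < l → ¬ R a (p i)) : R s t := by
  classical
  by_contra hst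
  obtain ⟨p, h0, hl, hp, hint⟩ := Nat.find_spec hwalk
  have hmin := fun m => @Nat.find_min _ _ hwalk m
  generalize Nat.find hwalk = l at h0 hl hp hint hmin
  have hl2 : 2 ≤ l := by
    by_contra h
    obtain rfl | rfl : l = 0 ∨ l = 1 := by omega
    · exact hst (by rw [← h0, ← hl]; exact hrefl _)
    · exact hst (by rw [← h0, ← hl]; exact hp 0 one_pos)
  -- A chord would shortcut the shortest walk.
  have hchord : ∀ i k, i + 2 ≤ k → k ≤ l → ¬ R (p i) (p k) := by
    intro i k hik hkl hr
    refine hmin (l - (k - i - 1)) (by omega)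
      ⟨fun j => if j ≤ i then p j else p (j + (k - i - 1)), by simpa using h0, ?_, ?_, ?_⟩
    · simp only
      rw [if_neg (by omega), ← hl]
      congr 1; omega
    · intro j hj
      simp only
      rcases lt_trichotomy j i with h | rfl | h
      · rw [if_pos h.le, if_pos (by omega)]
        exact hp j (by omega)
      · rw [if_pos le_rfl, if_neg (by omega), show j + 1 + (k - j - 1) = k by omega]
        exact hr
      · rw [if_neg (by omega), if_neg (by omega),
          show j + 1 + (k - i - 1) = j + (k - i - 1) + 1 by omega]
        exact hp _ (by omega)
    · intro j hj0 hj
      beta_reduce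
      split_ifs
      · exact hint j hj0 (by omega)
      · exact hint _ (by omega) (by omega)
  -- Close the walk through `a`. A chord at `a` would reach an interior vertex; any other is a chord
  -- of the walk.
  obtain ⟨i, k, hik, hki, hkn, hr⟩ := hR (l + 2)
    (fun j => if j = 0 ∨ j = l + 2 then a else p (j - 1)) (by omega) (by simp) (by
      intro j hj
      rcases Nat.eq_zero_or_pos j with rfl | hj0
      · simpa [h0] using has
      · rw [if_neg (by omega)]
        by_cases hjl : j = l + 1
        · rw [if_pos (by omega), hjl, Nat.add_sub_cancel, hl]
          exact hsymm _ _ hat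
        · rw [if_neg (by omega), show j + 1 - 1 = j - 1 + 1 by omega]
          exact hp _ (by omega))
  rw [if_neg (by omega : ¬ (k = 0 ∨ k = l + 2))] at hr
  by_cases hi : i = 0
  · rw [if_pos (Or.inl hi)] at hr
    exact hint (k - 1) (by omega) (by omega) hr
  · rw [if_neg (by omega)] at hr
    exact hchord (i - 1) (k - 1) (by omega) (by omega) hr

/-- A partial kernel on a finite chordal graph that has Gram representations on cliques has one
on the whole graph. -/
theorem IsChordalRel.hasGramOn {V : Type*} {R : V → V → Prop} (hR : IsChordalRel R)
    (hrefl : ∀ x, R x x) (hsymm : ∀ x y, R x y → R y x) {k : V → V → ℂ}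
    (hk : ∀ F : Finset V, (∀ x ∈ F, ∀ y ∈ F, R x y) → HasGramOn R k F) (F : Finset V) :
    HasGramOn R k F := by
  classical
  induction F using Finset.strongInduction with
  | H F ih =>
  by_cases hF : ∀ x ∈ F, ∀ y ∈ F, R x y
  · exact hk F hF
  push Not at hF
  obtain ⟨a, haF, b, hbF, hab⟩ := hF
  let r : V → V → Prop := fun x y => R x y ∧ (x ∈ F ∧ ¬ R a x) ∧ (y ∈ F ∧ ¬ R a y)
  -- The component of `b` among the non-neighbours of `a`. Its boundary `S` consists of neighbours
  -- of `a` and separates `C` from the rest of `F`.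
  let C := F.filter fun x => Relation.ReflTransGen r b x
  have hC : ∀ x ∈ C, x ∈ F ∧ ¬ R a x := by
    intro x hx
    have := (Finset.mem_filter.1 hx).2
    rcases Relation.ReflTransGen.cases_tail this with rfl | ⟨_, _, h⟩
    · exact ⟨hbF, hab⟩
    · exact h.2.2
  have hCstep : ∀ x ∈ C, ∀ y ∈ F, R x y → ¬ R a y → y ∈ C := fun x hx y hy hxy hay =>
    Finset.mem_filter.2 ⟨hy, (Finset.mem_filter.1 hx).2.tail ⟨hxy, hC x hx, hy, hay⟩⟩
  have hbC : b ∈ C := Finset.mem_filter.2 ⟨hbF, .refl⟩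
  have haC : a ∉ C := fun h => (hC a h).2 (hrefl a)
  let S := (F \ C).filter fun s => ∃ x ∈ C, R x s
  have hS : ∀ s ∈ S, s ∈ F ∧ s ∉ C ∧ (∃ x ∈ C, R x s) ∧ R a s := by
    intro s hs
    obtain ⟨h1, x, hx, hxs⟩ := Finset.mem_filter.1 hs
    obtain ⟨h1, h2⟩ := Finset.mem_sdiff.1 h1
    refine ⟨h1, h2, ⟨x, hx, hxs⟩, ?_⟩
    by_contra h
    exact h2 (hCstep x hx s h1 hxs h)
  have : Std.Symm r := ⟨fun x y h => ⟨hsymm _ _ h.1, h.2.2, h.2.1⟩⟩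
  have hSclique : ∀ s ∈ S, ∀ t ∈ S, R s t := by
    intro s hs t ht
    obtain ⟨-, -, ⟨x, hx, hxs⟩, has⟩ := hS s hs
    obtain ⟨-, -, ⟨y, hy, hyt⟩, hat⟩ := hS t ht
    have hbx := (Finset.mem_filter.1 hx).2
    have hxy : Relation.ReflTransGen r x y :=
      (symm_of (Relation.ReflTransGen r) hbx).trans (Finset.mem_filter.1 hy).2
    obtain ⟨n, p, h0, hn, hp⟩ := hxy.exists_walk
    have hpa : ∀ i ≤ n, ¬ R a (p i) := by
      intro i hi
      rcases hi.lt_or_eq with h | rfl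
      · exact (hp i h).2.1.2
      · rw [hn]; exact (hC y hy).2
    refine hR.adj_of_walk hrefl hsymm has hat ⟨n + 2,
      fun j => if j = 0 then s else if j = n + 2 then t else p (j - 1), by simp, by simp, ?_, ?_⟩
    · intro i hi
      simp only
      rcases Nat.eq_zero_or_pos i with rfl | hi0
      · simpa [h0] using hsymm _ _ hxs
      · rw [if_neg (by omega), if_neg (by omega), if_neg (by omega)]
        by_cases hin : i = n + 1
        · rw [if_pos (by omega), hin, Nat.add_sub_cancel, hn]
          exact hyt
        · rw [if_neg (by omega), show i + 1 - 1 = i - 1 + 1 by omega]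
          exact (hp _ (by omega)).1
    · intro i hi0 hi
      simp only
      rw [if_neg (by omega), if_neg (by omega)]
      exact hpa _ (by omega)
  have hSF : S ⊆ F := fun s hs => (hS s hs).1
  have hCF : C ⊆ F := Finset.filter_subset _ _
  have hinter : (C ∪ S) ∩ (F \ C) ⊆ S := by
    intro x hx
    simp only [Finset.mem_inter, Finset.mem_union, Finset.mem_sdiff] at hx
    tauto
  have hX : HasGramOn R k (C ∪ S) := ih _ <| by
    refine Finset.ssubset_iff_of_subset (Finset.union_subset hCF hSF) |>.2 ⟨a, haF, ?_⟩
    intro h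
    rcases Finset.mem_union.1 h with h | h
    · exact haC h
    · obtain ⟨x, hx, hxa⟩ := (hS a h).2.2.1
      exact (hC x hx).2 (hsymm _ _ hxa)
  have hY : HasGramOn R k (F \ C) := ih _ <|
    Finset.ssubset_iff_of_subset Finset.sdiff_subset |>.2 ⟨b, hbF, by simp [hbC]⟩
  have := hX.union hY hsymm
    (fun x hx y hy => hSclique x (hinter hx) y (hinter hy)) (by
      intro x hx hxY y hy hyX hxy
      obtain ⟨hyF, hyC⟩ := Finset.mem_sdiff.1 hy
      have hxC : x ∈ C := by
        rcases Finset.mem_union.1 hx with h | h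
        · exact h
        · exact absurd (Finset.mem_sdiff.2 ⟨(hS x h).1, (hS x h).2.1⟩) hxY
      exact hyX (Finset.mem_union_right _
        (Finset.mem_filter.2 ⟨hy, x, hxC, hxy⟩)))
  rwa [show C ∪ S ∪ F \ C = F by
    ext x
    simp only [Finset.mem_union, Finset.mem_sdiff]
    constructor
    · rintro ((h | h) | h)
      exacts [hCF h, hSF h, h.1]
    · tauto] at this

/-! ### Compactness: from finite sets to the whole vertex set -/

open Filter Topology in
/-- A partial kernel with bounded diagonal that has Gram representations on all finite sets
extends to a bounded positive semidefinite kernel. -/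
theorem exists_posSemidef_kernel {V : Type*} {R : V → V → Prop} {k : V → V → ℂ}
    (hrefl : ∀ x, R x x) {C : ℝ} (hC : ∀ x, ‖k x x‖ ≤ C) (hk : ∀ F, HasGramOn R k F) :
    ∃ K : V → V → ℂ, (∀ x y, ‖K x y‖ ≤ C) ∧ (∀ x y, R x y → K x y = k x y) ∧
      ∀ (n : ℕ) (s : Fin n → V), (Matrix.of fun i j => K (s i) (s j)).PosSemidef := by
  classical
  have hK : ∀ F : Finset V, ∃ K : V → V → ℂ, (∀ x ∈ F, ∀ y ∈ F, ‖K x y‖ ≤ C) ∧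
      (∀ x ∈ F, ∀ y ∈ F, R x y → K x y = k x y) ∧
      ∀ (n : ℕ) (s : Fin n → V), (Matrix.of fun i j => K (s i) (s j)).PosSemidef := by
    intro F
    obtain ⟨H, _, _, f, hf⟩ := hk F
    have hnorm : ∀ x ∈ F, ‖f x‖ * ‖f x‖ ≤ C := by
      intro x hx
      have := hC x
      rwa [← hf x hx x hx (hrefl x), inner_self_eq_norm_sq_to_K, norm_pow, RCLike.norm_ofReal,
        abs_norm, pow_two] at this
    refine ⟨fun x y => inner ℂ (f x) (f y), fun x hx y hy => ?_, hf,
      fun n s => Matrix.posSemidef_gram ℂ (fun i => f (s i))⟩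
    refine (norm_inner_le_norm _ _).trans ?_
    nlinarith [hnorm x hx, hnorm y hy, sq_nonneg (‖f x‖ - ‖f y‖)]
  choose κ hbound hext hpos using hK
  -- Finer than `atTop`, so any given pair eventually lies in `F`, where its kernel values stay in a
  -- compact disc.
  let U : Ultrafilter (Finset V) := Ultrafilter.of atTop
  have hU : (U : Filter (Finset V)) ≤ atTop := Ultrafilter.of_le _
  have hmem : ∀ x y : V, ∀ᶠ F in (U : Filter (Finset V)), x ∈ F ∧ y ∈ F := by
    intro x y
    filter_upwards [hU (mem_atTop {x, y})] with F hF
    exact ⟨hF (by simp), hF (by simp)⟩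
  have hlim : ∀ x y, ∃ z ∈ Metric.closedBall (0 : ℂ) C,
      Tendsto (fun F => κ F x y) U (𝓝 z) := by
    intro x y
    refine (isCompact_closedBall (0 : ℂ) C).ultrafilter_le_nhds' (U.map fun F => κ F x y)
      (Ultrafilter.mem_map.2 ?_)
    change ∀ᶠ F in (U : Filter (Finset V)), κ F x y ∈ Metric.closedBall (0 : ℂ) C
    filter_upwards [hmem x y] with F hF
    simpa using hbound F x hF.1 y hF.2
  choose K hKC hKlim using hlim
  refine ⟨K, fun x y => by simpa using hKC x y, fun x y hxy => ?_, fun n s => ?_⟩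
  · refine tendsto_nhds_unique (hKlim x y) (tendsto_const_nhds.congr' ?_)
    filter_upwards [hmem x y] with F hF
    exact (hext F x hF.1 y hF.2 hxy).symm
  · refine ⟨?_, fun c => ?_⟩
    · ext i j
      refine tendsto_nhds_unique ((hKlim (s j) (s i)).star) ((hKlim (s i) (s j)).congr fun F => ?_)
      exact ((hpos F n s).1.apply i j).symm
    · refine ge_of_tendsto (x := (U : Filter (Finset V)))
        (f := fun F => c.sum fun i xi => c.sum fun j xj => star xi * κ F (s i) (s j) * xj) ?_
        (Eventually.of_forall fun F => (hpos F n s).2 c)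
      exact tendsto_finsetSum _ fun i _ => tendsto_finsetSum _ fun j _ =>
        ((hKlim (s i) (s j)).const_mul _).mul_const _

/-! ### Averaging over an amenable group -/

theorem memℓp_top_of_norm_le {ι : Type*} {E : Type*} [NormedAddCommGroup E] {f : ι → E} {C : ℝ}
    (hf : ∀ x, ‖f x‖ ≤ C) : Memℓp f ⊤ :=
  memℓp_infty ⟨C, by rintro _ ⟨x, rfl⟩; exact hf x⟩

/-- An amenable group has a left-invariant mean on the bounded complex functions. -/
theorem IsDiscreteAmenable.exists_complex_mean {G : Type*} [Group G] (hG : IsDiscreteAmenable G) :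
    ∃ m : lp (fun _ : G => ℂ) ⊤ →ₗ[ℂ] ℂ,
      (∀ (c : ℂ) (f : lp (fun _ : G => ℂ) ⊤), (∀ x, f x = c) → m f = c) ∧
      (∀ f : lp (fun _ : G => ℂ) ⊤, (∀ x, 0 ≤ f x) → 0 ≤ m f) ∧
      (∀ f f' : lp (fun _ : G => ℂ) ⊤, (∀ x, f' x = star (f x)) → m f' = star (m f)) ∧
      ∀ (g : G) (f f' : lp (fun _ : G => ℂ) ⊤), (∀ x, f' x = f (g⁻¹ * x)) → m f' = m f := by
  obtain ⟨M, hM1, hMpos, hMinv⟩ := hG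
  let re : lp (fun _ : G => ℂ) ⊤ → lp (fun _ : G => ℝ) ⊤ := fun f =>
    ⟨fun x => (f x).re, memℓp_top_of_norm_le fun x =>
      (Complex.abs_re_le_norm _).trans (lp.norm_apply_le_norm ENNReal.top_ne_zero f x)⟩
  let im : lp (fun _ : G => ℂ) ⊤ → lp (fun _ : G => ℝ) ⊤ := fun f =>
    ⟨fun x => (f x).im, memℓp_top_of_norm_le fun x =>
      (Complex.abs_im_le_norm _).trans (lp.norm_apply_le_norm ENNReal.top_ne_zero f x)⟩
  have hre : ∀ f x, re f x = (f x).re := fun _ _ => rfl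
  have him : ∀ f x, im f x = (f x).im := fun _ _ => rfl
  have hconst : ∀ (c : ℝ) (f : lp (fun _ : G => ℝ) ⊤), (∀ x, f x = c) → M f = c := by
    intro c f hf
    have : f = c • (1 : lp (fun _ : G => ℝ) ⊤) := by
      ext x
      simp [hf]
    rw [this, map_smul, hM1, smul_eq_mul, mul_one]
  have hadd : ∀ f g, re (f + g) = re f + re g ∧ im (f + g) = im f + im g := fun f g =>
    ⟨by ext x; simp [hre], by ext x; simp [him]⟩
  have hsmul : ∀ (c : ℂ) f, re (c • f) = c.re • re f - c.im • im f ∧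
      im (c • f) = c.re • im f + c.im • re f := fun c f =>
    ⟨by ext x; simp [hre]; rfl, by ext x; simp [him]; rfl⟩
  refine ⟨{ toFun := fun f => ⟨M (re f), M (im f)⟩, map_add' := ?_, map_smul' := ?_ },
    ?_, ?_, ?_, ?_⟩
  · intro f g
    rw [(hadd f g).1, (hadd f g).2, map_add, map_add]
    rfl
  · intro c f
    rw [(hsmul c f).1, (hsmul c f).2]
    apply Complex.ext <;> simp
  · intro c f hf
    exact Complex.ext (hconst _ _ fun x => by rw [hre, hf]) (hconst _ _ fun x => by rw [him, hf])
  · intro f hf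
    rw [Complex.nonneg_iff]
    exact ⟨hMpos _ fun x => (Complex.nonneg_iff.1 (hf x)).1,
      (hconst 0 _ fun x => (Complex.nonneg_iff.1 (hf x)).2.symm).symm⟩
  · intro f f' hf
    have h1 : re f' = re f := by ext x; simp [hre, hf]
    have h2 : im f' = -im f := by ext x; simp [him, hf]
    apply Complex.ext <;> simp [h1, h2]
  · intro g f f' hf
    exact Complex.ext (hMinv g _ _ fun x => by rw [hre, hre, hf])
      (hMinv g _ _ fun x => by rw [him, him, hf])

/-- Averaging a bounded positive semidefinite kernel over an amenable group produces a positive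
definite function, which retains the values on the diagonals where the kernel is invariant. -/
theorem IsDiscreteAmenable.exists_isPosDefFun {G : Type*} [Group G] (hG : IsDiscreteAmenable G)
    {K : G → G → ℂ} {C : ℝ} (hC : ∀ x y, ‖K x y‖ ≤ C)
    (hK : ∀ (n : ℕ) (s : Fin n → G), (Matrix.of fun i j => K (s i) (s j)).PosSemidef) :
    ∃ v : G → ℂ, IsPosDefFun v ∧ ∀ (g : G) (c : ℂ), (∀ x, K (g * x) x = c) → v g = c := by
  obtain ⟨m, hconst, hpos, hstar, hinv⟩ := hG.exists_complex_mean
  let φ : G → G → lp (fun _ : G => ℂ) ⊤ := fun g h =>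
    ⟨fun x => K (g * x) (h * x), memℓp_top_of_norm_le fun x => hC _ _⟩
  have hφ : ∀ g h x, φ g h x = K (g * x) (h * x) := fun _ _ _ => rfl
  -- `φ g h` is the translate of `φ (g * h⁻¹) 1` by `h⁻¹`.
  have hmφ : ∀ g h, m (φ (g * h⁻¹) 1) = m (φ g h) := by
    intro g h
    refine (hinv h⁻¹ _ _ fun x => ?_).symm
    rw [hφ, hφ]
    congr 1 <;> group
  refine ⟨fun g => m (φ g 1), fun n s => ?_, fun g c hg => hconst _ _ fun x => ?_⟩
  · simp only [hmφ]
    refine ⟨?_, fun c => ?_⟩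
    · ext i j
      refine (hstar _ _ fun x => ?_).symm
      exact ((hK n fun i => s i * x).1.apply i j).symm
    · have : (c.sum fun i xi => c.sum fun j xj => star xi * m (φ (s i) (s j)) * xj) =
          m (c.sum fun i xi => c.sum fun j xj => (star xi * xj) • φ (s i) (s j)) := by
        simp only [Finsupp.sum, map_sum, map_smul, smul_eq_mul]
        exact Finset.sum_congr rfl fun i _ => Finset.sum_congr rfl fun j _ => by ring
      simp only [Matrix.of_apply]
      rw [this]
      refine hpos _ fun x => ?_
      have := (hK n fun i => s i * x).2 c
      refine this.trans_eq ?_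
      simp only [Finsupp.sum, lp.coeFn_sum, Finset.sum_apply, lp.coeFn_smul, Pi.smul_apply,
        smul_eq_mul, hφ, Matrix.of_apply]
      exact Finset.sum_congr rfl fun i _ => Finset.sum_congr rfl fun j _ => by ring
  · rw [hφ, one_mul, hg]

/-! ### From the group to the graph -/

theorem descProd_mul_inv {G : Type*} [Group G] (v : ℕ → G) (i m : ℕ) :
    descProd (fun j => v j * (v (j - 1))⁻¹) (i + 1) m = v (i + m) * (v i)⁻¹ := by
  induction m with
  | zero => simp [descProd]
  | succ m ih =>
    rw [descProd, ih, show i + 1 + m - 1 = i + m by omega, show i + 1 + m = i + (m + 1) by omega]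
    group

/-- The quotients v_j v_{j-1}⁻¹ of a closed walk telescope to 1, and their partial products are the
quotients of two vertices, so a chord in the group is a chord of the walk. -/
theorem IsChordalSubset.isChordalRel {G : Type*} [Group G] {E : Set G} (hE : IsChordalSubset E) :
    IsChordalRel fun x y : G => x * y⁻¹ ∈ E := by
  have hsymm : ∀ x y : G, x * y⁻¹ ∈ E → y * x⁻¹ ∈ E := fun x y h => by
    simpa using hE.inv_mem _ h
  intro n v hn hv hadj
  obtain ⟨i, hi, k, hk, hik, hki, hmem⟩ := hE.exists_chord n (fun j => v j * (v (j - 1))⁻¹) hn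
    (fun j hj => by
      obtain ⟨h1, h2⟩ := Finset.mem_Icc.1 hj
      have := hsymm _ _ (hadj (j - 1) (by omega))
      rwa [Nat.sub_add_cancel h1] at this)
    (by simpa [hv] using descProd_mul_inv v 0 n)
  obtain ⟨h1, -⟩ := Finset.mem_Icc.1 hi
  obtain ⟨-, h2⟩ := Finset.mem_Icc.1 hk
  refine ⟨i - 1, k - 1, by omega, by omega, by omega, hsymm _ _ ?_⟩
  have := descProd_mul_inv v (i - 1) (k - i)
  rw [Nat.sub_add_cancel h1, show i - 1 + (k - i) = k - 1 by omega] at this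
  rwa [← this]

theorem IsPosDefOn.hasGramOn {G : Type*} [Group G] {E : Set G} {u : E → ℂ} (hu : IsPosDefOn E u)
    {k : G → G → ℂ} (hk : ∀ x y (h : x * y⁻¹ ∈ E), k x y = u ⟨x * y⁻¹, h⟩) (F : Finset G)
    (hF : ∀ x ∈ F, ∀ y ∈ F, x * y⁻¹ ∈ E) : HasGramOn (fun x y => x * y⁻¹ ∈ E) k F := by
  classical
  let e := F.equivFin
  have hs : ∀ i j, (e.symm i : G) * (e.symm j : G)⁻¹ ∈ E := fun i j =>
    hF _ (e.symm i).2 _ (e.symm j).2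
  obtain ⟨m, w, hw⟩ := Matrix.posSemidef_iff_eq_sum_vecMulVec.1
    (hu F.card (fun i => (e.symm i : G)) hs)
  -- The coordinates are conjugated because the inner product is conjugate-linear in its first
  -- argument.
  refine ⟨EuclideanSpace ℂ (Fin m), inferInstance, inferInstance,
    fun x => WithLp.toLp 2 fun l => if hx : x ∈ F then star (w l (e ⟨x, hx⟩)) else 0, ?_⟩
  intro x hx y hy hxy
  have := congrFun (congrFun hw (e ⟨x, hx⟩)) (e ⟨y, hy⟩)
  simp only [Matrix.of_apply, Equiv.symm_apply_apply, Matrix.sum_apply,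
    Matrix.vecMulVec_apply, Pi.star_apply] at this
  rw [hk x y hxy, this, PiLp.inner_apply]
  refine Finset.sum_congr rfl fun l _ => ?_
  simp [hx, hy, mul_comm]

theorem mainTheorem5 {G : Type*} [Group G] (hG : IsDiscreteAmenable G)
    (E : Set G) (hE : IsChordalSubset E) (u : E → ℂ) (hu : IsPosDefOn E u) :
    ∃ v : G → ℂ, IsPosDefFun v ∧ ∀ x : E, v x = u x := by
  classical
  let k : G → G → ℂ := fun x y => if h : x * y⁻¹ ∈ E then u ⟨x * y⁻¹, h⟩ else 0
  have hk : ∀ x y (h : x * y⁻¹ ∈ E), k x y = u ⟨x * y⁻¹, h⟩ := fun x y h => dif_pos h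
  have hrefl : ∀ x : G, x * x⁻¹ ∈ E := fun x => by simpa using hE.one_mem
  obtain ⟨K, hKC, hKk, hKpos⟩ := exists_posSemidef_kernel (C := ‖u ⟨1, hE.one_mem⟩‖) hrefl
    (fun x => by simp [hk x x (hrefl x)])
    (hE.isChordalRel.hasGramOn hrefl (fun x y h => by simpa using hE.inv_mem _ h)
      (hu.hasGramOn hk))
  obtain ⟨v, hv, hvK⟩ := hG.exists_isPosDefFun hKC hKpos
  refine ⟨v, hv, fun g => hvK g _ fun x => ?_⟩
  have hg : (g : G) * x * x⁻¹ ∈ E := by simp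
  rw [hKk _ _ hg, hk _ _ hg]
  simp
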